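/- A \emph{task system} on a finite set $S$ of system states is given by a transition cost function $d\colon S\times S\to[0,\infty)$ (metrics are a special case; neither symmetry nor the triangle inequality is required), a set $S_0\subseteq S$ of possible initial states (for instance a single state, or all of $S$), and a set $\mathcal T\subseteq[0,\infty]^S$ of admissible tasks, each of which has at least one finite entry. An input is a pair $(I,x)$ of an initial state $I\in S_0$ and a finite sequence $x=(x_1,\dots,x_n)$ of tasks from $\mathcal T$. A solution is a sequence $y=(y_1,\dots,y_n)\in S^n$; with $y_0:=I$, its cost is $\sum_{i=1}^n\bigl(d(y_{i-1},y_i)+x_i(y_i)\bigr)$. Let $\mathrm{Opt}(I,x)$ be the minimum cost of a solution. A randomized online algorithm $R$ computes each $y_i$ from $I,x_1,\dots,x_i$ and a random tape, an infinite sequence of independent uniform bits; $\mathrm{cost}(R(I,x))$ is the resulting random cost. For $r\ge 0$, $R$ is \emph{$r$-competitive in expectation} if there is a constant $\alpha$ such that $\mathbb E[\mathrm{cost}(R(I,x))]\le r\cdot\mathrm{Opt}(I,x)+\alpha$ for all inputs $(I,x)$. It is \emph{$r$-competitive with high probability} (with respect to the optimal cost) if for every $\beta\ge1$ there is a constant $\alpha$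 such that, for all inputs $(I,x)$, \[\Pr\bigl[\mathrm{cost}(R(I,x))\ge r\cdot\mathrm{Opt}(I,x)+\alpha\bigr]\le\bigl(2+\mathrm{Opt}(I,x)\bigr)^{-\beta}.\] \textbf{Theorem.} Consider a task system on a finite state space and let $A$ be a randomized online algorithm for it that is $r$-competitive in expectation. Then, for every $\varepsilon>0$, there is a randomized online algorithm $A'$ for the same task system that is $(1+\varepsilon)r$-competitive with high probability, with respect to the optimal cost. -/

import Mathlib

open MeasureTheory
open scoped NNReal ENNReal

/-- A task system with system states `S`. Transition costs are finite and non-negative; neither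
symmetry nor the triangle inequality is required. A task (request) is a vector of processing costs,
one for each system state, where `∞` is allowed. The sets of initial configurations and of
admissible tasks are arbitrary, except that every task can be processed at finite cost somewhere,
so that every request sequence is valid. -/
structure TaskSystem (S : Type*) where
  /-- cost of moving from one system state to another -/
  dist : S → S → ℝ≥0
  /-- the initial configurations -/
  init : Set S
  /-- the admissible tasks -/
  tasks : Set (S → ℝ≥0∞)
  exists_ne_top : ∀ T ∈ tasks, ∃ s, T s ≠ ∞

namespace TaskSystem

variable {S : Type*}

/-- The requests of a task system. -/
abbrev Request (P : TaskSystem S) : Type _ := {T : S → ℝ≥0∞ // T ∈ P.tasks}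

/-- The cost of serving the requests `x₁, …, xₙ` from the system state `s` with the answers
`y₁, …, yₙ`: the `i`-th task is processed in the state `yᵢ`, after a transition from `yᵢ₋₁`
(where `y₀ = s`). It is only used for lists of equal length. -/
def cost (P : TaskSystem S) : S → List P.Request → List S → ℝ≥0∞
  | _, [], _ => 0
  | _, _ :: _, [] => 0
  | s, T :: x, t :: y => (P.dist s t : ℝ≥0∞) + T.1 t + P.cost t x y

/-- The optimal (offline) cost of the request sequence `x` from the system state `s`. -/
noncomputable def opt (P : TaskSystem S) (s : S) (x : List P.Request) : ℝ≥0∞ :=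
  ⨅ (y : List S) (_ : y.length = x.length), P.cost s x y

/-- The law of the random tape: an infinite sequence of independent uniform bits. -/
noncomputable def tapeMeasure : Measure (ℕ → Bool) :=
  Measure.infinitePi fun _ : ℕ => (PMF.uniformOfFintype Bool).toMeasure

/-- A randomized online algorithm: the `i`-th answer is `answer φ I [x₁, …, xᵢ]`, determined by the
random tape `φ`, the initial configuration `I` and the requests seen so far. Each answer is a random
variable (with values in the discrete space `S`). -/
structure RandomizedOnlineAlgorithm (P : TaskSystem S) where
  answer : (ℕ → Bool) → P.init → List P.Request → S
  measurableSet_answer_eq : ∀ (I : P.init) (x : List P.Request) (s : S),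
    MeasurableSet {φ | answer φ I x = s}

namespace RandomizedOnlineAlgorithm

variable {P : TaskSystem S}

/-- The output sequence on the input `(I, x)` with the random tape `φ`. -/
def output (A : P.RandomizedOnlineAlgorithm) (φ : ℕ → Bool) (I : P.init) (x : List P.Request) :
    List S :=
  (List.range x.length).map fun i => A.answer φ I (x.take (i + 1))

/-- The cost of the algorithm on the input `(I, x)` with the random tape `φ`. -/
def cost (A : P.RandomizedOnlineAlgorithm) (φ : ℕ → Bool) (I : P.init) (x : List P.Request) :
    ℝ≥0∞ :=
  P.cost I x (A.output φ I x)

/-- `r`-competitive in expectation. -/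
def CompetitiveInExpectation (A : P.RandomizedOnlineAlgorithm) (r : ℝ≥0) : Prop :=
  ∃ α : ℝ≥0, ∀ (I : P.init) (x : List P.Request),
    ∫⁻ φ, A.cost φ I x ∂tapeMeasure ≤ r * P.opt I x + α

/-- `r`-competitive with high probability, with respect to the optimal cost. -/
def CompetitiveWHP (A : P.RandomizedOnlineAlgorithm) (r : ℝ≥0) : Prop :=
  ∀ β : ℝ, 1 ≤ β → ∃ α : ℝ≥0, ∀ (I : P.init) (x : List P.Request),
    tapeMeasure {φ | r * P.opt I x + α ≤ A.cost φ I x} ≤ (2 + P.opt I x) ^ (-β)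

end RandomizedOnlineAlgorithm

end TaskSystem

namespace TaskSystem

variable {S : Type*}

/-! The guarantee on `A` concerns only the mean, so `A'` produces many independent runs of `A`. It
cuts the input into phases, each simulating `A` on fresh bits as if started in `I`. A phase ends
once its optimal cost reaches a large constant `C`, or once the simulated cost would exceed a
truncation level `L`. Pretending to be in `I` and serving the last request greedily costs at most
two transitions, hence `2 * D`, plus the least processing cost of that request. Optimal costs of
consecutive pieces add up to within `D`, so for large `C` this overhead fits into `η * r * C`.

Concentration comes from an exponential moment: for a small `l`, `E exp (l * cost) ≤ 8 * exp (l * (1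
+ η) * r * Opt)`, by strong induction on the length of the input (`restartMoment_le`). Let `w` be
the part of the first phase before its optimal cost reaches `C`; it does not depend on the tape. If
`A` stays below `L` on `w`, the phase is complete and the optimum of the remainder drops
accordingly; otherwise, an event made rare by Markov's inequality, the cost is bounded and no
progress is claimed. The net increment is a bounded variable of mean at most `-1`, whose exponential
moment is at most 1 (`lintegral_exp_le_one`).

Markov's inequality for the exponential, at ratio `(1 + 2 * η) * r`, then gives a tail exponentially
small in `Opt`, stronger than any required power. The argument uses `1 ≤ r`; for `r < 1` optimal
costs are bounded and `A` itself works. -/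

instance : IsProbabilityMeasure tapeMeasure := by
  unfold tapeMeasure; infer_instance

/-! ### Splitting a tape into two independent tapes -/

/-- The first of the two independent tapes contained in a tape. -/
def leftTape (φ : ℕ → Bool) : ℕ → Bool := fun n => φ (Equiv.natSumNatEquivNat (.inl n))

/-- The second of the two independent tapes contained in a tape. -/
def rightTape (φ : ℕ → Bool) : ℕ → Bool := fun n => φ (Equiv.natSumNatEquivNat (.inr n))

theorem measurable_leftTape : Measurable leftTape :=
  measurable_pi_lambda _ fun _ => measurable_pi_apply _

theorem measurable_rightTape : Measurable rightTape :=
  measurable_pi_lambda _ fun _ => measurable_pi_apply _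

/-- The tape that contains two given tapes. -/
def joinTape (p : (ℕ → Bool) × (ℕ → Bool)) : ℕ → Bool :=
  fun n => Sum.elim p.1 p.2 (Equiv.natSumNatEquivNat.symm n)

theorem measurable_joinTape : Measurable joinTape := by
  refine measurable_pi_lambda _ fun n => ?_
  unfold joinTape
  cases Equiv.natSumNatEquivNat.symm n with
  | inl k => exact (measurable_pi_apply k).comp measurable_fst
  | inr k => exact (measurable_pi_apply k).comp measurable_snd

/-- The product measure is determined by finite boxes, and the preimage of a box under `joinTape` is
a product of two boxes, one for each half of the coordinates. -/
theorem map_joinTape : (tapeMeasure.prod tapeMeasure).map joinTape = tapeMeasure := by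
  classical
  refine Measure.eq_infinitePi _ fun s t ht => ?_
  set e := Equiv.natSumNatEquivNat
  set s' : Finset (ℕ ⊕ ℕ) := s.map e.symm.toEmbedding
  have hmem : ∀ a, a ∈ s' ↔ e a ∈ s := fun a => by simp [s']
  have hpre : joinTape ⁻¹' (Set.pi s t) =
      (Set.pi s'.toLeft fun n => t (e (.inl n))) ×ˢ (Set.pi s'.toRight fun n => t (e (.inr n))) := by
    ext p
    simp only [Set.mem_preimage, Set.mem_pi, Set.mem_prod, Finset.mem_coe, Finset.mem_toLeft,
      Finset.mem_toRight, hmem]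
    constructor
    · intro h
      exact ⟨fun n hn => by simpa [joinTape, e] using h _ hn,
        fun n hn => by simpa [joinTape, e] using h _ hn⟩
    · rintro ⟨h1, h2⟩ i hi
      obtain ⟨a, rfl⟩ := e.surjective i
      cases a with
      | inl n => simpa [joinTape, e] using h1 n hi
      | inr n => simpa [joinTape, e] using h2 n hi
  rw [Measure.map_apply measurable_joinTape (.pi s.countable_toSet fun _ _ => ht _), hpre,
    Measure.prod_prod, tapeMeasure, Measure.infinitePi_pi _ fun _ _ => ht _,
    Measure.infinitePi_pi _ fun _ _ => ht _]
  have : ∏ i ∈ s, (PMF.uniformOfFintype Bool).toMeasure (t i) =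
      ∏ a ∈ s', (PMF.uniformOfFintype Bool).toMeasure (t (e a)) := by
    simp [s']
  rw [this, Finset.prod_sum_eq_prod_toLeft_mul_prod_toRight]

theorem measurePreserving_splitTape :
    MeasurePreserving (fun φ => (leftTape φ, rightTape φ)) tapeMeasure
      (tapeMeasure.prod tapeMeasure) := by
  have hm : Measurable fun φ => (leftTape φ, rightTape φ) :=
    measurable_leftTape.prodMk measurable_rightTape
  refine ⟨hm, ?_⟩
  conv_lhs => rw [← map_joinTape]
  rw [Measure.map_map hm measurable_joinTape]
  have : (fun φ => (leftTape φ, rightTape φ)) ∘ joinTape = id := by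
    funext p
    simp only [Function.comp_apply, id]
    refine Prod.ext ?_ ?_ <;> funext n <;> simp [leftTape, rightTape, joinTape]
  rw [this, Measure.map_id]

theorem measurable_comp_of_countable {Ω α β : Type*} [MeasurableSpace Ω] [MeasurableSpace β]
    [Countable α] {f : Ω → α} (hf : ∀ a, MeasurableSet {ω | f ω = a}) (F : α → β) :
    Measurable fun ω => F (f ω) := by
  intro B _
  have : (fun ω => F (f ω)) ⁻¹' B = ⋃ a ∈ F ⁻¹' B, {ω | f ω = a} := by
    ext ω; simp
  rw [this]
  exact MeasurableSet.biUnion (Set.to_countable _) fun a _ => hf a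

namespace RandomizedOnlineAlgorithm

variable {P : TaskSystem S}

theorem length_output (A : P.RandomizedOnlineAlgorithm) (φ : ℕ → Bool) (I : P.init)
    (x : List P.Request) : (A.output φ I x).length = x.length := by
  simp [output]

theorem output_append_singleton (A : P.RandomizedOnlineAlgorithm) (φ : ℕ → Bool) (I : P.init)
    (x : List P.Request) (T : P.Request) :
    A.output φ I (x ++ [T]) = A.output φ I x ++ [A.answer φ I (x ++ [T])] := by
  unfold output
  rw [List.length_append, List.length_singleton, List.range_succ, List.map_append]
  congr 1
  · refine List.map_congr_left fun i hi => ?_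
    rw [List.take_append_of_le_length (by simpa using hi)]
  · simp [List.take_of_length_le]

theorem measurableSet_output_eq (A : P.RandomizedOnlineAlgorithm) (I : P.init)
    (x : List P.Request) (l : List S) : MeasurableSet {φ | A.output φ I x = l} := by
  unfold output
  generalize List.range x.length = k
  induction k generalizing l with
  | nil => simp
  | cons i k ih =>
    cases l with
    | nil => simp
    | cons s l =>
      simp only [List.map_cons, List.cons.injEq]
      exact (A.measurableSet_answer_eq I _ s).inter (ih l)

theorem measurable_cost [Finite S] (A : P.RandomizedOnlineAlgorithm) (I : P.init)
    (x : List P.Request) : Measurable fun φ => A.cost φ I x :=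
  measurable_comp_of_countable (A.measurableSet_output_eq I x) (P.cost I x)

/-! ### The restarting algorithm -/

open Classical in
/-- The answers of the restarting algorithm: the algorithm `A` is simulated on the tape `ψ`, as if
it had been started in `I` at the beginning of the current phase, whose requests so far are `h`.
The phase ends when its optimal cost reaches `C` or when the cost of the simulated algorithm would
exceed `L`. The last request of a phase is served in the state chosen by `g`, and the next phase
uses a fresh part of the reserve tape `φ`. -/
noncomputable def restartOutput (A : P.RandomizedOnlineAlgorithm) (g : P.Request → S)
    (C L : ℝ≥0∞) (I : P.init) :
    (ℕ → Bool) → (ℕ → Bool) → List P.Request → List P.Request → List S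
  | _, _, _, [] => []
  | ψ, φ, h, T :: x =>
    if C ≤ P.opt I (h ++ [T]) ∨ L < A.cost ψ I (h ++ [T]) then
      g T :: A.restartOutput g C L I (leftTape φ) (rightTape φ) [] x
    else
      A.answer ψ I (h ++ [T]) :: A.restartOutput g C L I ψ φ (h ++ [T]) x

variable (A : P.RandomizedOnlineAlgorithm) (g : P.Request → S) (C L : ℝ≥0∞) (I : P.init)

theorem length_restartOutput (ψ φ : ℕ → Bool) (h x : List P.Request) :
    (A.restartOutput g C L I ψ φ h x).length = x.length := by
  induction x generalizing ψ φ h with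
  | nil => simp [restartOutput]
  | cons T x ih =>
    unfold restartOutput
    split_ifs <;> simp [ih]

/-- This is the online property: it lets `restart` answer with the last entry for each prefix and
still reproduce the whole list. -/
theorem restartOutput_take (ψ φ : ℕ → Bool) (h x : List P.Request) (n : ℕ) :
    A.restartOutput g C L I ψ φ h (x.take n) = (A.restartOutput g C L I ψ φ h x).take n := by
  induction x generalizing ψ φ h n with
  | nil => simp [restartOutput]
  | cons T x ih =>
    cases n with
    | zero => simp [restartOutput]
    | succ n =>
      simp only [List.take_succ_cons]
      rw [restartOutput, restartOutput]
      split_ifs <;> simp [ih]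

theorem measurableSet_restartOutput_eq [Finite S] (h x : List P.Request) (l : List S) :
    MeasurableSet {p : (ℕ → Bool) × (ℕ → Bool) |
      A.restartOutput g C L I p.1 p.2 h x = l} := by
  induction x generalizing h l with
  | nil => simp [restartOutput]
  | cons T x ih =>
    set E : Set ((ℕ → Bool) × (ℕ → Bool)) :=
      {p | C ≤ P.opt I (h ++ [T]) ∨ L < A.cost p.1 I (h ++ [T])} with hE
    have hEm : MeasurableSet E :=
      (MeasurableSet.const _).union (measurableSet_lt measurable_const
        ((A.measurable_cost I _).comp measurable_fst))
    cases l with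
    | nil =>
      convert MeasurableSet.empty
      ext p
      simp only [Set.mem_ofPred_eq, Set.mem_empty_iff_false, iff_false]
      intro hp
      simpa [hp] using (A.length_restartOutput g C L I p.1 p.2 h (T :: x)).symm
    | cons s l =>
      have hs : {p : (ℕ → Bool) × (ℕ → Bool) |
          A.restartOutput g C L I p.1 p.2 h (T :: x) = s :: l} =
          (E ∩ ({_p | g T = s} ∩ (fun p : (ℕ → Bool) × (ℕ → Bool) =>
            (leftTape p.2, rightTape p.2)) ⁻¹'
              {p | A.restartOutput g C L I p.1 p.2 [] x = l})) ∪
          (Eᶜ ∩ (Prod.fst ⁻¹' {ψ | A.answer ψ I (h ++ [T]) = s} ∩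
            {p | A.restartOutput g C L I p.1 p.2 (h ++ [T]) x = l})) := by
        ext p
        by_cases hp : C ≤ P.opt I (h ++ [T]) ∨ L < A.cost p.1 I (h ++ [T])
        · simp [restartOutput, hE, hp]
        · simp [restartOutput, hE, hp]
      rw [hs]
      refine (hEm.inter ((MeasurableSet.const _).inter ?_)).union
        (hEm.compl.inter (MeasurableSet.inter ?_ (ih _ l)))
      · exact ((measurable_leftTape.comp measurable_snd).prodMk
          (measurable_rightTape.comp measurable_snd)) (ih [] l)
      · exact measurable_fst (A.measurableSet_answer_eq I _ s)

/-- The algorithm that simulates `A` in phases, see `restartOutput`. -/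
noncomputable def restart [Finite S] (A : P.RandomizedOnlineAlgorithm) (g : P.Request → S)
    (C L : ℝ≥0∞) : P.RandomizedOnlineAlgorithm where
  answer φ I x := (A.restartOutput g C L I (leftTape φ) (rightTape φ) [] x).getLastD I
  measurableSet_answer_eq I x s := by
    have := measurable_comp_of_countable (β := Prop)
      (A.measurableSet_restartOutput_eq g C L I [] x) fun l => l.getLastD (I : S) = s
    exact measurableSet_setOfPred.2 (this.comp measurePreserving_splitTape.measurable)

theorem output_restart [Finite S] (φ : ℕ → Bool) (x : List P.Request) :
    (A.restart g C L).output φ I x =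
      A.restartOutput g C L I (leftTape φ) (rightTape φ) [] x := by
  refine List.ext_getElem (by simp [length_output, length_restartOutput]) fun i h1 h2 => ?_
  have hi : i + 1 ≤ (A.restartOutput g C L I (leftTape φ) (rightTape φ) [] x).length := h2
  simp only [output, restart, List.getElem_map, List.getElem_range, restartOutput_take]
  rw [List.getLastD_eq_getLast?, List.getLast?_eq_getElem?, List.length_take, min_eq_left hi]
  simp [h2]

theorem cost_restart [Finite S] (φ : ℕ → Bool) (x : List P.Request) :
    (A.restart g C L).cost φ I x =
      P.cost I x (A.restartOutput g C L I (leftTape φ) (rightTape φ) [] x) := by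
  rw [cost, output_restart]

end RandomizedOnlineAlgorithm

/-! ### Costs and optima of concatenated request sequences -/

theorem cost_append (P : TaskSystem S) (s : S) (a b : List P.Request) (y z : List S)
    (h : y.length = a.length) :
    P.cost s (a ++ b) (y ++ z) = P.cost s a y + P.cost (y.getLastD s) b z := by
  induction a generalizing s y with
  | nil =>
    obtain rfl : y = [] := by simpa using h
    simp [cost]
  | cons T a ih =>
    cases y with
    | nil => simp at h
    | cons t y =>
      simp only [List.cons_append, cost, List.getLastD_cons]
      rw [ih t y (by simpa using h), add_assoc, add_assoc, add_assoc]

/-- Only the first transition depends on the starting state, so no triangle inequality is needed. -/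
theorem cost_le_add_cost {P : TaskSystem S} {D : ℝ≥0} (hD : ∀ s t, P.dist s t ≤ D) (s s' : S)
    (x : List P.Request) (y : List S) : P.cost s x y ≤ D + P.cost s' x y := by
  cases x with
  | nil => simp [cost]
  | cons T x =>
    cases y with
    | nil => simp [cost]
    | cons t y =>
      have h : (P.dist s t : ℝ≥0∞) ≤ D := by exact_mod_cast hD s t
      simp only [cost]
      calc (P.dist s t : ℝ≥0∞) + T.1 t + P.cost t x y ≤ D + T.1 t + P.cost t x y := by gcongr
        _ ≤ D + T.1 t + P.cost t x y + P.dist s' t := le_self_add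
        _ = _ := by ring

theorem opt_le_cost (P : TaskSystem S) (s : S) {x : List P.Request} {y : List S}
    (h : y.length = x.length) : P.opt s x ≤ P.cost s x y :=
  iInf₂_le y h

theorem le_opt_append {P : TaskSystem S} {s : S} {a b : List P.Request} {c : ℝ≥0∞}
    (h : ∀ y z : List S, y.length = a.length → z.length = b.length →
      c ≤ P.cost s a y + P.cost (y.getLastD s) b z) : c ≤ P.opt s (a ++ b) := by
  refine le_iInf₂ fun y hy => ?_
  rw [List.length_append] at hy
  have h1 : (y.take a.length).length = a.length := by simp [hy]
  rw [← List.take_append_drop a.length y, cost_append P s a b _ _ h1]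
  exact h _ _ h1 (by simp [hy])

theorem opt_le_opt_append (P : TaskSystem S) (s : S) (a b : List P.Request) :
    P.opt s a ≤ P.opt s (a ++ b) :=
  le_opt_append fun _ _ hy _ => (P.opt_le_cost s hy).trans le_self_add

/-- Cut a solution of `a ++ b` after `a`; restarting its second half from `t` changes only one
transition. -/
theorem opt_add_opt_le {P : TaskSystem S} {D : ℝ≥0} (hD : ∀ s t, P.dist s t ≤ D) (s t : S)
    (a b : List P.Request) : P.opt s a + P.opt t b ≤ P.opt s (a ++ b) + D := by
  rw [← tsub_le_iff_right]
  refine le_opt_append fun y z hy hz => ?_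
  rw [tsub_le_iff_right]
  calc P.opt s a + P.opt t b ≤ P.cost s a y + (D + P.cost (y.getLastD s) b z) :=
        add_le_add (P.opt_le_cost s hy) ((P.opt_le_cost t hz).trans (cost_le_add_cost hD _ _ _ _))
    _ = _ := by ring

theorem opt_add_le_opt_append_singleton {P : TaskSystem S} (s : S) (a : List P.Request)
    {T : P.Request} {m : ℝ≥0∞} (hm : ∀ t, m ≤ T.1 t) : P.opt s a + m ≤ P.opt s (a ++ [T]) := by
  refine le_opt_append fun y z hy hz => ?_
  obtain ⟨t, rfl⟩ : ∃ t, z = [t] := List.length_eq_one_iff.1 hz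
  refine add_le_add (P.opt_le_cost s hy) ((hm t).trans ?_)
  simp [cost]

theorem opt_ne_top (P : TaskSystem S) (s : S) (x : List P.Request) : P.opt s x ≠ ∞ := by
  choose f hf using fun T : P.Request => P.exists_ne_top T.1 T.2
  have key : P.cost s x (x.map f) ≠ ∞ := by
    induction x generalizing s with
    | nil => simp [cost]
    | cons T x ih => simp [cost, hf, ih]
  exact ne_top_of_le_ne_top key (P.opt_le_cost s (by simp))

theorem _root_.List.or_exists_append_cons {α : Type*} (p : List α → Prop) (h0 : p [])
    (x : List α) : p x ∨ ∃ w a v, x = w ++ a :: v ∧ p w ∧ ¬ p (w ++ [a]) := by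
  induction x using List.reverseRecOn with
  | nil => exact .inl h0
  | append_singleton x a ih =>
    rcases ih with h | ⟨w, b, v, rfl, h1, h2⟩
    · by_cases h' : p (x ++ [a])
      · exact .inl h'
      · exact .inr ⟨x, a, [], rfl, h, h'⟩
    · exact .inr ⟨w, b, v ++ [a], by simp, h1, h2⟩

/-! ### Pathwise cost of the first phase -/

namespace RandomizedOnlineAlgorithm

variable {P : TaskSystem S} (A : P.RandomizedOnlineAlgorithm)

theorem opt_le_cost (φ : ℕ → Bool) (I : P.init) (x : List P.Request) :
    P.opt I x ≤ A.cost φ I x :=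
  P.opt_le_cost I (A.length_output φ I x)

/-- The system state after the requests `x`. -/
def state (φ : ℕ → Bool) (I : P.init) (x : List P.Request) : S := (A.output φ I x).getLastD I

theorem cost_append_singleton (φ : ℕ → Bool) (I : P.init) (x : List P.Request) (T : P.Request) :
    A.cost φ I (x ++ [T]) = A.cost φ I x + (P.dist (A.state φ I x) (A.answer φ I (x ++ [T])) +
      T.1 (A.answer φ I (x ++ [T]))) := by
  rw [cost, output_append_singleton, cost_append P _ _ _ _ _ (A.length_output φ I x)]
  simp [cost, state, TaskSystem.cost]

theorem state_append_singleton (φ : ℕ → Bool) (I : P.init) (x : List P.Request) (T : P.Request) :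
    A.state φ I (x ++ [T]) = A.answer φ I (x ++ [T]) := by
  rw [state, output_append_singleton]
  simp

theorem cost_le_cost_append (φ : ℕ → Bool) (I : P.init) (x z : List P.Request) :
    A.cost φ I x ≤ A.cost φ I (x ++ z) := by
  induction z using List.reverseRecOn with
  | nil => simp
  | append_singleton z T ih =>
    rw [← List.append_assoc, cost_append_singleton]
    exact ih.trans le_self_add

variable (g : P.Request → S) (C L : ℝ≥0∞) (I : P.init)

/-- The end of the phase is determined by `ψ` alone. Keeping `φ` quantified inside makes it possible
to integrate over the reserve tape afterwards. The prefix `h` is there for the induction. -/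
theorem restartOutput_cases (ψ : ℕ → Bool) (x h : List P.Request) (hC : P.opt I h < C)
    (hL : A.cost ψ I h ≤ L) :
    (P.opt I (h ++ x) < C ∧ A.cost ψ I (h ++ x) ≤ L ∧
      ∀ φ, A.cost ψ I h + P.cost (A.state ψ I h) x (A.restartOutput g C L I ψ φ h x) =
        A.cost ψ I (h ++ x)) ∨
    ∃ u T v, x = u ++ T :: v ∧ P.opt I (h ++ u) < C ∧ A.cost ψ I (h ++ u) ≤ L ∧
      (C ≤ P.opt I (h ++ u ++ [T]) ∨ L < A.cost ψ I (h ++ u ++ [T])) ∧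
      ∀ φ, A.cost ψ I h + P.cost (A.state ψ I h) x (A.restartOutput g C L I ψ φ h x) =
        A.cost ψ I (h ++ u) + (P.dist (A.state ψ I (h ++ u)) (g T) + T.1 (g T) +
          P.cost (g T) v (A.restartOutput g C L I (leftTape φ) (rightTape φ) [] v)) := by
  induction x generalizing h with
  | nil => exact .inl (by simpa [TaskSystem.cost] using ⟨hC, hL⟩)
  | cons T x ih =>
    by_cases hp : C ≤ P.opt I (h ++ [T]) ∨ L < A.cost ψ I (h ++ [T])
    · exact .inr ⟨[], T, x, rfl, by simpa using hC, by simpa using hL, by simpa using hp,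
        fun φ => by simp [restartOutput, hp, TaskSystem.cost]⟩
    · have hp' := hp
      push Not at hp'
      have hstep : ∀ φ, A.cost ψ I h +
          P.cost (A.state ψ I h) (T :: x) (A.restartOutput g C L I ψ φ h (T :: x)) =
          A.cost ψ I (h ++ [T]) + P.cost (A.state ψ I (h ++ [T])) x
            (A.restartOutput g C L I ψ φ (h ++ [T]) x) := fun φ => by
        rw [restartOutput, if_neg hp, cost_append_singleton, state_append_singleton,
          TaskSystem.cost]
        simp only [add_assoc]
      rcases ih (h ++ [T]) hp'.1 hp'.2 with ⟨h1, h2, h3⟩ | ⟨u, T', v, rfl, h1, h2, h3, h4⟩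
      · exact .inl ⟨by simpa using h1, by simpa using h2, fun φ => by
          rw [hstep, h3]; simp⟩
      · exact .inr ⟨T :: u, T', v, rfl, by simpa using h1, by simpa using h2,
          by simpa using h3, fun φ => by rw [hstep, h4]; simp⟩

variable {D : ℝ≥0} (hD : ∀ s t, P.dist s t ≤ D)
include hD

/-- One `D` pays for starting in `s` instead of `I`, the other for the move to `g T`. -/
theorem cost_restartOutput_cases (hC : 0 < C) (ψ : ℕ → Bool) (x : List P.Request) (s : S) :
    (P.opt I x < C ∧ A.cost ψ I x ≤ L ∧
      ∀ φ, P.cost s x (A.restartOutput g C L I ψ φ [] x) ≤ D + A.cost ψ I x) ∨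
    ∃ u T v, x = u ++ T :: v ∧ P.opt I u < C ∧ A.cost ψ I u ≤ L ∧
      (C ≤ P.opt I (u ++ [T]) ∨ L < A.cost ψ I (u ++ [T])) ∧
      ∀ φ, P.cost s x (A.restartOutput g C L I ψ φ [] x) ≤
        A.cost ψ I u + 2 * D + T.1 (g T) +
          P.cost (g T) v (A.restartOutput g C L I (leftTape φ) (rightTape φ) [] v) := by
  have h0 : A.cost ψ I [] = 0 := by simp [cost, TaskSystem.cost]
  have h0' : P.opt I [] = 0 := le_antisymm
    ((P.opt_le_cost I (y := []) rfl).trans (by simp [TaskSystem.cost])) zero_le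
  have hs := fun φ => cost_le_add_cost hD s (A.state ψ I []) x
    (A.restartOutput g C L I ψ φ [] x)
  rcases A.restartOutput_cases g C L I ψ x [] (by rwa [h0']) (by simp [h0]) with
    ⟨h1, h2, h3⟩ | ⟨u, T, v, rfl, h1, h2, h3, h4⟩
  · refine .inl ⟨h1, h2, fun φ => ?_⟩
    have := h3 φ
    rw [h0, zero_add, List.nil_append] at this
    rw [← this]
    exact hs φ
  · refine .inr ⟨u, T, v, rfl, h1, h2, h3, fun φ => (hs φ).trans ?_⟩
    have := h4 φ
    rw [h0, zero_add, List.nil_append] at this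
    rw [this]
    have hd : (P.dist (A.state ψ I u) (g T) : ℝ≥0∞) ≤ D := by exact_mod_cast hD _ _
    set c := P.cost (g T) v (A.restartOutput g C L I (leftTape φ) (rightTape φ) [] v)
    calc (D : ℝ≥0∞) + (A.cost ψ I u + (P.dist (A.state ψ I u) (g T) + T.1 (g T) + c))
        ≤ D + (A.cost ψ I u + (D + T.1 (g T) + c)) := by gcongr
      _ = _ := by ring

variable {g} (hg : ∀ (T : P.Request) s, T.1 (g T) ≤ T.1 s) {C L I}
include hg

/-- A phase cut by overrun: it ends inside `w`, before its simulated cost passes `L`. How much of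
the optimum it used up is unknown, so the remainder is only bounded by the full optimum plus `D`. -/
theorem cost_restartOutput_of_lt {ψ : ℕ → Bool} {w z : List P.Request} (hC : P.opt I w < C)
    (hL : L < A.cost ψ I w) (s : S) :
    ∃ T v, v.length < (w ++ z).length ∧ P.opt I v ≤ P.opt I (w ++ z) + D ∧
      ∀ φ, P.cost s (w ++ z) (A.restartOutput g C L I ψ φ [] (w ++ z)) ≤
        L + 2 * D + C +
          P.cost (g T) v (A.restartOutput g C L I (leftTape φ) (rightTape φ) [] v) := by
  rcases A.cost_restartOutput_cases g C L I hD (zero_le.trans_lt hC) ψ (w ++ z) s with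
    ⟨h1, h2, h3⟩ | ⟨u, T, v, hx, h1, h2, h3, h4⟩
  · exact absurd ((A.cost_le_cost_append ψ I w z).trans h2) (not_le.2 hL)
  · have hw : ∃ t, w = u ++ [T] ++ t := by
      rcases List.append_eq_append_iff.1 hx with ⟨a, rfl, -⟩ | ⟨a, rfl, ha⟩
      · exact absurd ((A.cost_le_cost_append ψ I w a).trans h2) (not_le.2 hL)
      · cases a with
        | nil => exact absurd h2 (not_le.2 (by simpa using hL))
        | cons T' a =>
          simp only [List.cons_append, List.cons.injEq] at ha
          exact ⟨a, by simp [ha.1]⟩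
    obtain ⟨t, rfl⟩ := hw
    -- Every solution pays at least the minimum of `T`, and `u ++ [T]` is a prefix of `w`, whose
    -- optimum is below `C`.
    have hT : T.1 (g T) ≤ C :=
      le_add_self.trans (((opt_add_le_opt_append_singleton _ u (hg T)).trans
        (P.opt_le_opt_append I _ t)).trans hC.le)
    refine ⟨T, v, by rw [hx]; simp; omega, ?_, fun φ => (h4 φ).trans (by gcongr)⟩
    have := opt_add_opt_le hD (I : S) I (u ++ [T]) v
    rw [hx]
    simp only [List.append_assoc, List.singleton_append] at this
    exact le_add_self.trans this

omit hg in
-- A complete phase ends exactly at `T`. The simulated cost is needed only up to `w`, where its mean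
-- is under control because `P.opt I w < C`; the optimum of `w ++ [T]` may be arbitrarily large.
theorem cost_restartOutput_of_le {ψ : ℕ → Bool} {w z : List P.Request} {T : P.Request}
    (hC : P.opt I w < C) (hC' : C ≤ P.opt I (w ++ [T])) (hL : A.cost ψ I w ≤ L) (s : S)
    (φ : ℕ → Bool) :
    P.cost s (w ++ T :: z) (A.restartOutput g C L I ψ φ [] (w ++ T :: z)) ≤
      A.cost ψ I w + 2 * D + T.1 (g T) +
        P.cost (g T) z (A.restartOutput g C L I (leftTape φ) (rightTape φ) [] z) := by
  rcases A.cost_restartOutput_cases g C L I hD (zero_le.trans_lt hC) ψ (w ++ T :: z) s with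
    ⟨h1, h2, h3⟩ | ⟨u, T', v, hx, h1, h2, h3, h4⟩
  · have := P.opt_le_opt_append I (w ++ [T]) z
    simp only [List.append_assoc, List.singleton_append] at this
    exact absurd (hC'.trans this) (not_le.2 h1)
  · have : w = u := by
      rcases List.append_eq_append_iff.1 hx with ⟨a, rfl, ha⟩ | ⟨a, rfl, ha⟩
      · cases a with
        | nil => simp
        | cons T₁ a =>
          simp only [List.cons_append, List.cons.injEq] at ha
          obtain ⟨rfl, -⟩ := ha
          have := P.opt_le_opt_append I (w ++ [T]) a
          simp only [List.append_assoc, List.singleton_append] at this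
          exact absurd (hC'.trans this) (not_le.2 h1)
      · cases a with
        | nil => simp
        | cons T₁ a =>
          simp only [List.cons_append, List.cons.injEq] at ha
          obtain ⟨rfl, -⟩ := ha
          rcases h3 with h3 | h3
          · have := P.opt_le_opt_append I (u ++ [T']) a
            simp only [List.append_assoc, List.singleton_append] at this
            exact absurd (h3.trans this) (not_le.2 hC)
          · have := A.cost_le_cost_append ψ I (u ++ [T']) a
            simp only [List.append_assoc, List.singleton_append] at this
            exact absurd (this.trans hL) (not_le.2 h3)
    subst this
    simp only [List.append_cancel_left_eq, List.cons.injEq] at hx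
    obtain ⟨rfl, rfl⟩ := hx
    exact h4 φ

omit hg in
theorem cost_restartOutput_of_opt_lt {ψ : ℕ → Bool} {x : List P.Request}
    (hC : P.opt I x < C) (hL : A.cost ψ I x ≤ L) (s : S) (φ : ℕ → Bool) :
    P.cost s x (A.restartOutput g C L I ψ φ [] x) ≤ D + L := by
  rcases A.cost_restartOutput_cases g C L I hD (zero_le.trans_lt hC) ψ x s with
    ⟨h1, h2, h3⟩ | ⟨u, T, v, rfl, h1, h2, h3, h4⟩
  · exact (h3 φ).trans (by gcongr)
  · rcases h3 with h3 | h3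
    · have := P.opt_le_opt_append I (u ++ [T]) v
      simp only [List.append_assoc, List.singleton_append] at this
      exact absurd (h3.trans this) (not_le.2 hC)
    · have := A.cost_le_cost_append ψ I (u ++ [T]) v
      simp only [List.append_assoc, List.singleton_append] at this
      exact absurd (this.trans hL) (not_le.2 h3)

end RandomizedOnlineAlgorithm

/-! ### Exponential moments and tail estimates -/

/-- The exponential `exp (l * c)` of a cost. -/
noncomputable def expCost (l : ℝ≥0) (c : ℝ≥0∞) : ℝ≥0∞ := EReal.exp ((l * c : ℝ≥0∞) : EReal)

theorem expCost_add (l : ℝ≥0) (c d : ℝ≥0∞) : expCost l (c + d) = expCost l c * expCost l d := by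
  rw [expCost, mul_add, EReal.coe_ennreal_add, EReal.exp_add, expCost, expCost]

theorem expCost_mono (l : ℝ≥0) : Monotone (expCost l) := fun _ _ h =>
  EReal.exp_monotone (EReal.coe_ennreal_le_coe_ennreal_iff.2 (by gcongr))

theorem expCost_coe (l c : ℝ≥0) : expCost l c = ENNReal.ofReal (Real.exp (l * c)) := by
  rw [expCost, ← ENNReal.coe_mul, ← NNReal.coe_mul]
  rfl

theorem expCost_ne_top {l : ℝ≥0} {c : ℝ≥0∞} (hc : c ≠ ∞) : expCost l c ≠ ∞ := by
  lift c to ℝ≥0 using hc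
  simp [expCost_coe]

theorem exists_coe_eq_of_ne_top {c : ℝ≥0∞} (hc : c ≠ ∞) : ∃ o : ℝ≥0, (o : ℝ≥0∞) = c :=
  ⟨_, ENNReal.coe_toNNReal hc⟩

section Probability

variable {Ω : Type*} [MeasurableSpace Ω] {μ : Measure Ω}

theorem measure_lt_le_of_lintegral_le {Y : Ω → ℝ≥0∞} (hY : Measurable Y) {a L : ℝ≥0}
    (ha : ∫⁻ ω, Y ω ∂μ ≤ a) (hL : 0 < L) {n : ℝ≥0} (hn : 0 < n) (haL : n * a ≤ L) :
    μ {ω | (L : ℝ≥0∞) < Y ω} ≤ (n : ℝ≥0∞)⁻¹ := by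
  have hL' : (L : ℝ≥0∞) ≠ 0 := by exact_mod_cast hL.ne'
  calc μ {ω | (L : ℝ≥0∞) < Y ω} ≤ μ {ω | (L : ℝ≥0∞) ≤ Y ω} := measure_mono fun ω hω => by
          rw [Set.mem_ofPred_eq] at *; exact hω.le
    _ ≤ (∫⁻ ω, Y ω ∂μ) / L := meas_ge_le_lintegral_div hY.aemeasurable hL' ENNReal.coe_ne_top
    _ ≤ a / L := by gcongr
    _ ≤ (n : ℝ≥0∞)⁻¹ := by
      rw [ENNReal.div_le_iff hL' ENNReal.coe_ne_top, ← ENNReal.coe_inv hn.ne',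
        ← ENNReal.coe_mul, ENNReal.coe_le_coe, ← div_eq_inv_mul, le_div_iff₀ hn, mul_comm]
      exact haL

/-- With `U` the increment and `l = 1 / M ^ 2`, the bound `|U| ≤ M` gives `exp (l * U) ≤ 1 + l * U +
(l * U) ^ 2 ≤ 1 + l * (U + 1)`. Hypothesis `h` forces the mean of `U` to be at most `-1`. -/
theorem lintegral_exp_le_one [IsProbabilityMeasure μ] {Y : Ω → ℝ≥0∞} (hY : Measurable Y) {a L : ℝ≥0}
    (ha : ∫⁻ ω, Y ω ∂μ ≤ a) (hL : 0 < L) {b₁ b₂ M : ℝ} (hM : 1 ≤ M) (hb : 0 ≤ b₁ + b₂)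
    (h₁ : b₁ ≤ M) (h₁' : L ≤ M + b₁) (h₂ : L + b₂ ≤ M)
    (h : 1 + a + (b₁ + b₂) * a / L ≤ b₁) :
    ∫⁻ ω, ENNReal.ofReal (Real.exp ((M ^ 2)⁻¹ *
      (if Y ω ≤ L then (Y ω).toReal - b₁ else L + b₂))) ∂μ ≤ 1 := by
  set l := (M ^ 2)⁻¹ with hl
  set X : Ω → ℝ := fun ω => (min (Y ω) L).toReal with hX
  have hl0 : 0 < l := by positivity
  have hLr : (0 : ℝ) < L := hL
  have hX0 : ∀ ω, 0 ≤ X ω := fun ω => ENNReal.toReal_nonneg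
  have hXL : ∀ ω, X ω ≤ L := fun ω => by
    have := ENNReal.toReal_mono (b := (L : ℝ≥0∞)) ENNReal.coe_ne_top (min_le_right (Y ω) L)
    simpa using this
  have hXm : Measurable X := (hY.min measurable_const).ennreal_toReal
  have hXi : Integrable X μ := Integrable.of_bound hXm.aestronglyMeasurable L
    (Filter.Eventually.of_forall fun ω => by rw [Real.norm_of_nonneg (hX0 ω)]; exact hXL ω)
  have hXa : ∫ ω, X ω ∂μ ≤ a := by
    rw [integral_toReal (hY.min measurable_const).aemeasurable
      (Filter.Eventually.of_forall fun ω => (min_le_right _ _).trans_lt ENNReal.coe_lt_top)]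
    have := (lintegral_mono fun ω => min_le_left (Y ω) L).trans ha
    simpa using ENNReal.toReal_mono ENNReal.coe_ne_top this
  -- The slope for which `q * X - b₁` takes the value `L + b₂` at `X = L`; this line majorizes the
  -- increment, which builds Markov's inequality into the estimate.
  set q := 1 + (b₁ + b₂) / L with hq
  have hq0 : 0 ≤ q := by positivity
  have hlM : l * M ^ 2 = 1 := inv_mul_cancel₀ (by positivity)
  have hlM1 : l * M ≤ 1 := by
    have : l * M * 1 ≤ l * M * M := by gcongr
    nlinarith
  set F : Ω → ℝ := fun ω => 1 + l - l * b₁ + l * q * X ω with hF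
  have hle : ∀ ω, Real.exp (l * (if Y ω ≤ L then (Y ω).toReal - b₁ else L + b₂)) ≤ F ω := by
    intro ω
    have key : ∀ U : ℝ, |U| ≤ M → U ≤ q * X ω - b₁ → Real.exp (l * U) ≤ F ω := by
      intro U hU hU'
      have h1 : |l * U| ≤ 1 := by
        rw [abs_mul, abs_of_pos hl0]
        exact (mul_le_mul_of_nonneg_left hU hl0.le).trans hlM1
      have h2 := (abs_le.1 (Real.abs_exp_sub_one_sub_id_le h1)).2
      have h3 : U ^ 2 ≤ M ^ 2 := sq_le_sq' (by linarith [(abs_le.1 hU).1]) (abs_le.1 hU).2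
      have h4 : (l * U) ^ 2 ≤ l := by
        calc (l * U) ^ 2 = l * (l * U ^ 2) := by ring
          _ ≤ l * (l * M ^ 2) := by gcongr
          _ = l := by rw [hlM, mul_one]
      have h5 : l * U ≤ l * (q * X ω - b₁) := by gcongr
      simp only [hF]
      nlinarith
    split_ifs with hω
    · have hXY : X ω = (Y ω).toReal := by simp [hX, min_eq_left hω]
      rw [← hXY]
      refine key _ (abs_le.2 ⟨by linarith [hX0 ω], by linarith [hXL ω]⟩) ?_
      have : 0 ≤ (b₁ + b₂) / L * X ω := mul_nonneg (by positivity) (hX0 ω)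
      rw [hq]; linarith
    · have hXY : X ω = L := by simp [hX, min_eq_right (not_le.1 hω).le]
      refine key _ (abs_le.2 ⟨by linarith, by linarith⟩) ?_
      rw [hXY, hq, add_mul, div_mul_cancel₀ _ hLr.ne']
      linarith
  have hFi : Integrable F μ := (integrable_const _).add (hXi.const_mul _)
  have hF0 : ∀ ω, 0 ≤ F ω := fun ω => (Real.exp_pos _).le.trans (hle ω)
  calc _ ≤ ∫⁻ ω, ENNReal.ofReal (F ω) ∂μ :=
        lintegral_mono fun ω => ENNReal.ofReal_le_ofReal (hle ω)
    _ = ENNReal.ofReal (∫ ω, F ω ∂μ) :=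
        (ofReal_integral_eq_lintegral_ofReal hFi (Filter.Eventually.of_forall hF0)).symm
    _ ≤ 1 := by
      rw [ENNReal.ofReal_le_one]
      simp only [hF]
      rw [integral_add (integrable_const _) (hXi.const_mul _), integral_const_mul]
      simp only [integral_const, probReal_univ, one_smul]
      have h1 : l * q * ∫ ω, X ω ∂μ ≤ l * q * a := by gcongr
      have h2 : q * a = a + (b₁ + b₂) * a / L := by rw [hq]; ring
      have h3 : l * (1 + q * a) ≤ l * b₁ := by gcongr; linarith
      nlinarith

end Probability

/-- A linear function outgrows `β * log (2 + o)`: apply `log y ≤ y - 1` at `y = (a / β) * (2 + o)`.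
-/
theorem exists_rpow_le_exp {k a β : ℝ} (ha : 0 < a) (hβ : 0 < β) (hk : 0 < k) (l : ℝ)
    (hl : 0 < l) :
    ∃ α : ℝ≥0, ∀ o : ℝ, 0 ≤ o → k * Real.exp (-(a * o + l * α)) ≤ (2 + o) ^ (-β) := by
  set c : ℝ := Real.log k + a * 2 + β * (-1 - Real.log (a / β)) with hc
  refine ⟨(c / l).toNNReal, fun o ho => ?_⟩
  have h1 : c ≤ l * (c / l).toNNReal := by
    have := Real.le_coe_toNNReal (c / l)
    rw [div_le_iff₀ hl] at this
    linarith
  have ho2 : 0 < 2 + o := by linarith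
  have hab : 0 < a / β := by positivity
  have h2 := Real.log_le_sub_one_of_pos (mul_pos hab ho2)
  rw [Real.log_mul hab.ne' ho2.ne'] at h2
  have h3 : β * Real.log (2 + o) ≤ a * (2 + o) + β * (-1 - Real.log (a / β)) := by
    have := mul_le_mul_of_nonneg_left h2 hβ.le
    have h4 : β * (a / β * (2 + o) - 1) = a * (2 + o) - β := by field_simp
    rw [h4] at this
    linarith
  have hk' : k = Real.exp (Real.log k) := (Real.exp_log hk).symm
  rw [Real.rpow_def_of_pos ho2]
  nth_rewrite 1 [hk']
  rw [← Real.exp_add, Real.exp_le_exp]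
  linarith

/-! ### The exponential moment of the restarting algorithm -/

namespace RandomizedOnlineAlgorithm

variable {P : TaskSystem S}

/-- The exponential moment of the cost of the restarting algorithm on `x`, from the start of a phase
in the system state `s`. -/
noncomputable def restartMoment (A : P.RandomizedOnlineAlgorithm) (g : P.Request → S)
    (C L : ℝ≥0∞) (I : P.init) (l : ℝ≥0) (s : S) (x : List P.Request) : ℝ≥0∞ :=
  ∫⁻ p, expCost l (P.cost s x (A.restartOutput g C L I p.1 p.2 [] x))
    ∂(tapeMeasure.prod tapeMeasure)

variable [Finite S] (A : P.RandomizedOnlineAlgorithm) (g : P.Request → S) (C L : ℝ≥0∞) (I : P.init)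
  (l : ℝ≥0)

theorem measurable_comp_restartOutput (F : List S → ℝ≥0∞) (x : List P.Request) :
    Measurable fun p : (ℕ → Bool) × (ℕ → Bool) => F (A.restartOutput g C L I p.1 p.2 [] x) :=
  measurable_comp_of_countable (A.measurableSet_restartOutput_eq g C L I [] x) F

theorem lintegral_tape_eq_restartMoment (s : S) (x : List P.Request) :
    ∫⁻ φ, expCost l (P.cost s x (A.restartOutput g C L I (leftTape φ) (rightTape φ) [] x))
      ∂tapeMeasure = A.restartMoment g C L I l s x :=
  measurePreserving_splitTape.lintegral_comp
    (A.measurable_comp_restartOutput g C L I (fun y => expCost l (P.cost s x y)) x)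

theorem restartMoment_eq_lintegral_lintegral (s : S) (x : List P.Request) :
    A.restartMoment g C L I l s x = ∫⁻ ψ, ∫⁻ φ,
      expCost l (P.cost s x (A.restartOutput g C L I ψ φ [] x)) ∂tapeMeasure ∂tapeMeasure :=
  lintegral_prod _
    (A.measurable_comp_restartOutput g C L I (fun y => expCost l (P.cost s x y)) x).aemeasurable

theorem lintegral_expCost_le_mul_restartMoment {f : (ℕ → Bool) → ℝ≥0∞} {c : ℝ≥0∞} {s : S}
    {x : List P.Request} (hf : ∀ φ, f φ ≤ c +
      P.cost s x (A.restartOutput g C L I (leftTape φ) (rightTape φ) [] x)) :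
    ∫⁻ φ, expCost l (f φ) ∂tapeMeasure ≤ expCost l c * A.restartMoment g C L I l s x := by
  rw [← lintegral_tape_eq_restartMoment, ← lintegral_const_mul]
  · exact lintegral_mono fun φ => (expCost_mono l (hf φ)).trans_eq (expCost_add l _ _)
  · exact (A.measurable_comp_restartOutput g C L I (fun y => expCost l (P.cost s x y)) x).comp
      measurePreserving_splitTape.measurable

theorem restartMoment_le {A : P.RandomizedOnlineAlgorithm} {g : P.Request → S}
    {r α D η C L M : ℝ≥0} (hr : 1 ≤ r)
    (hA : ∀ (I : P.init) x, ∫⁻ φ, A.cost φ I x ∂tapeMeasure ≤ r * P.opt I x + α)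
    (hD : ∀ s t, P.dist s t ≤ D) (hg : ∀ (T : P.Request) s, T.1 (g T) ≤ T.1 s)
    (hC : 0 < C) (hC' : 2 + α + (2 * D + (1 + η) * r * D) ≤ η * r * C)
    (hL : 0 < L) (hL₁ : (r * C + η * r * C + C) * (r * C + α) ≤ L) (hL₂ : 8 * (r * C + α) ≤ L)
    (hM : M = L + (2 * D + (1 + η) * r * D) + C + r * C + η * r * C + 1)
    (I : P.init) (x : List P.Request) (s : S) :
    A.restartMoment g C L I (M ^ 2)⁻¹ s x ≤
      8 * expCost (M ^ 2)⁻¹ ((1 + η) * r * P.opt I x) := by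
  induction hn : x.length using Nat.strong_induction_on generalizing x s with
  | _ n ih =>
  subst hn
  have ih' : ∀ v : List P.Request, v.length < x.length → ∀ s,
      A.restartMoment g C L I (M ^ 2)⁻¹ s v ≤
        8 * expCost (M ^ 2)⁻¹ ((1 + η) * r * P.opt I v) := fun v hv s => ih _ hv v s rfl
  clear ih
  have hM1 : 1 ≤ M := by rw [hM]; exact le_add_self
  have hM0 : 0 < M := one_pos.trans_le hM1
  have hlM : (M ^ 2)⁻¹ * M ≤ 1 := by
    rw [inv_mul_le_iff₀ (by positivity), mul_one, sq]
    exact le_mul_of_one_le_left' hM1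
  set l := (M ^ 2)⁻¹ with hl
  set R := (1 + η) * r with hR
  set B := 2 * D + R * D with hB
  have hRc : ∀ o : ℝ≥0∞, (1 + (η : ℝ≥0∞)) * r * o = R * o := fun o => by
    rw [hR]; push_cast; ring
  simp only [hRc] at ih' ⊢
  have hfail : ∀ w z : List P.Request, x = w ++ z → P.opt I w < C → ∀ ψ, ↑L < A.cost ψ I w →
      ∫⁻ φ, expCost l (P.cost s x (A.restartOutput g C L I ψ φ [] x)) ∂tapeMeasure ≤
        8 * expCost l (R * P.opt I x) * expCost l (L + B + C : ℝ≥0) := by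
    rintro w z rfl hw ψ hψ
    obtain ⟨T, v, hv, hov, hφ⟩ := A.cost_restartOutput_of_lt hD hg (z := z) hw hψ s
    calc _ ≤ expCost l (L + 2 * D + C) * A.restartMoment g C L I l (g T) v :=
          A.lintegral_expCost_le_mul_restartMoment g C L I l hφ
      _ ≤ expCost l (L + 2 * D + C) * (8 * expCost l (R * (P.opt I (w ++ z) + D))) := by
          gcongr
          refine (ih' v hv (g T)).trans ?_
          gcongr
          exact expCost_mono l (by gcongr)
      _ = _ := by
          rw [mul_left_comm, ← expCost_add, mul_assoc, ← expCost_add]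
          congr 2
          rw [hB]
          push_cast
          ring
  rw [restartMoment_eq_lintegral_lintegral]
  have hlint : ∀ w, P.opt I w < C →
      ∫⁻ ψ, A.cost ψ I w ∂tapeMeasure ≤ (r * C + α : ℝ≥0) := fun w hw =>
    (hA I w).trans (by push_cast; gcongr)
  rcases List.or_exists_append_cons (fun w => P.opt I w < C)
    (lt_of_le_of_lt (P.opt_le_cost I (y := []) rfl) (by simpa [TaskSystem.cost] using hC)) x with
    hx | ⟨w, T, z, rfl, hw, hwT⟩
  -- Here the optimum stays below `C`. Without overrun the factor is at most `e`; an overrun has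
  -- probability at most `1 / 8` and factor at most `8 * e`. The sum is `2 * e ≤ 8`, so the constant
  -- 8 reproduces itself.
  · set e := ENNReal.ofReal (Real.exp 1) with he
    have hexp : ∀ c ≤ M, expCost l c ≤ e := fun c hc => by
      rw [expCost_coe]
      refine ENNReal.ofReal_le_ofReal (Real.exp_le_exp.2 ?_)
      have : l * c ≤ 1 := le_trans (by gcongr) hlM
      exact_mod_cast this
    have hm : MeasurableSet {ψ | (L : ℝ≥0∞) < A.cost ψ I x} :=
      measurableSet_lt measurable_const (A.measurable_cost I x)
    have h1 : 1 ≤ expCost l (R * P.opt I x) := by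
      have := expCost_mono l (zero_le : 0 ≤ R * P.opt I x)
      simpa [expCost] using this
    calc _ ≤ ∫⁻ ψ, (expCost l (R * P.opt I x) * e + 8 * expCost l (R * P.opt I x) * e *
          {ψ | (L : ℝ≥0∞) < A.cost ψ I x}.indicator 1 ψ) ∂tapeMeasure := by
          refine lintegral_mono fun ψ => ?_
          by_cases hψ : (L : ℝ≥0∞) < A.cost ψ I x
          · refine (hfail x [] (by simp) hx ψ hψ).trans (le_trans ?_ le_add_self)
            rw [Set.indicator_of_mem (by exact hψ), Pi.one_apply, mul_one]
            gcongr
            exact hexp _ (by rw [hM]; exact le_self_add.trans (le_self_add.trans le_self_add))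
          · refine le_trans ?_ le_self_add
            calc _ ≤ ∫⁻ _φ, expCost l (D + L : ℝ≥0) ∂tapeMeasure :=
                  lintegral_mono fun φ => expCost_mono l (by
                    simpa using A.cost_restartOutput_of_opt_lt (g := g) hD hx (not_lt.1 hψ) s φ)
              _ ≤ 1 * e := by
                  rw [lintegral_const, measure_univ, mul_one, one_mul]
                  refine hexp _ ?_
                  rw [hM, hB, ← NNReal.coe_le_coe]
                  push_cast
                  have h₁ := D.2
                  have h₂ : (0 : ℝ) ≤ R * D := by positivity
                  have h₃ : (0 : ℝ) ≤ r * C := by positivity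
                  have h₄ : (0 : ℝ) ≤ η * r * C := by positivity
                  have h₅ := C.2
                  change 0 ≤ (D : ℝ) at h₁
                  change 0 ≤ (C : ℝ) at h₅
                  linarith
              _ ≤ _ := by gcongr
      _ ≤ expCost l (R * P.opt I x) * e + 8 * expCost l (R * P.opt I x) * e * (8 : ℝ≥0∞)⁻¹ := by
          rw [lintegral_add_left measurable_const, lintegral_const, measure_univ, mul_one,
            lintegral_const_mul _ (measurable_one.indicator hm), lintegral_indicator_one hm]
          gcongr
          exact measure_lt_le_of_lintegral_le (A.measurable_cost I x) (hlint x hx) hL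
            (n := 8) (by norm_num) hL₂
      _ = expCost l (R * P.opt I x) * (e * (8 * (8 : ℝ≥0∞)⁻¹) + e) := by ring
      _ ≤ expCost l (R * P.opt I x) * 8 := by
          gcongr
          rw [ENNReal.mul_inv_cancel (by norm_num) (by norm_num), mul_one, he,
            ← ENNReal.ofReal_add (Real.exp_pos 1).le (Real.exp_pos 1).le]
          have : Real.exp 1 + Real.exp 1 ≤ 8 := by linarith [Real.exp_one_lt_d9]
          simpa using ENNReal.ofReal_le_ofReal this
      _ = _ := mul_comm _ _
  · have hwT' : C ≤ P.opt I (w ++ [T]) := not_lt.1 hwT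
    obtain ⟨o, ho⟩ := exists_coe_eq_of_ne_top (P.opt_ne_top I w)
    obtain ⟨o', ho'⟩ := exists_coe_eq_of_ne_top (P.opt_ne_top I (w ++ [T]))
    obtain ⟨ox, hox⟩ := exists_coe_eq_of_ne_top (P.opt_ne_top I (w ++ T :: z))
    obtain ⟨oz, hoz⟩ := exists_coe_eq_of_ne_top (P.opt_ne_top I z)
    have hm := opt_add_le_opt_append_singleton (P := P) (I : S) w (hg T)
    obtain ⟨m, hmT⟩ := exists_coe_eq_of_ne_top
      (ne_top_of_le_ne_top (P.opt_ne_top I (w ++ [T])) (le_add_self.trans hm))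
    have hxz := opt_add_opt_le hD (I : S) I (w ++ [T]) z
    simp only [List.append_assoc, List.singleton_append] at hxz
    rw [← ho, ← ho', ← hmT] at hm
    rw [← hox, ← hoz, ← ho'] at hxz
    have hlw := hA I w
    rw [← ho] at hlw
    have hm' : (o : ℝ) + m ≤ o' := by exact_mod_cast hm
    have hxz' : (o' : ℝ) + oz ≤ ox + D := by exact_mod_cast hxz
    have hCo' : (C : ℝ) ≤ o' := by
      rw [← ho'] at hwT'; exact_mod_cast hwT'
    have hoC : (o : ℝ) < C := by
      have := hw
      rw [← ho] at this; exact_mod_cast this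
    have hr' : (1 : ℝ) ≤ r := by exact_mod_cast hr
    have hBr : (B : ℝ) = 2 * D + R * D := by rw [hB]; push_cast; ring
    have hRr : (R : ℝ) = r + η * r := by rw [hR]; push_cast; ring
    have hMr : (M : ℝ) = L + B + C + r * C + η * r * C + 1 := by rw [hM]; push_cast; ring
    have hC'r : 2 + (α : ℝ) + B ≤ η * r * C := by exact_mod_cast hC'
    have hL₁r : ((r : ℝ) * C + η * r * C + C) * (r * C + α) ≤ L := by exact_mod_cast hL₁
    have hLr : (0 : ℝ) < L := hL
    have hCr : (0 : ℝ) < C := hC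
    have hro : (r : ℝ) * o ≤ r * C := by gcongr
    have hro0 : (0 : ℝ) ≤ r * o := by positivity
    have hηrC : (0 : ℝ) ≤ η * r * C := by positivity
    have hB0 : (0 : ℝ) ≤ B := B.2
    have hα0 : (0 : ℝ) ≤ α := α.2
    -- After removing `R * Opt`, the exponent is at most `Y - b₁` for a complete phase and `L + b₂`
    -- after an overrun.
    set b₁ : ℝ := r * o + η * r * C - B with hb₁
    set b₂ : ℝ := B + C with hb₂
    calc _ ≤ ∫⁻ ψ, 8 * expCost l (R * P.opt I (w ++ T :: z)) *
          ENNReal.ofReal (Real.exp (((M : ℝ) ^ 2)⁻¹ *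
            (if A.cost ψ I w ≤ L then (A.cost ψ I w).toReal - b₁ else L + b₂))) ∂tapeMeasure := by
          refine lintegral_mono fun ψ => ?_
          by_cases hψ : A.cost ψ I w ≤ L
          · rw [if_pos hψ]
            obtain ⟨Y, hY⟩ := exists_coe_eq_of_ne_top (ne_top_of_le_ne_top ENNReal.coe_ne_top hψ)
            calc _ ≤ expCost l (A.cost ψ I w + 2 * D + T.1 (g T)) *
                  A.restartMoment g C L I l (g T) z :=
                  A.lintegral_expCost_le_mul_restartMoment g C L I l
                    (A.cost_restartOutput_of_le hD hw hwT' hψ s)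
              _ ≤ expCost l (A.cost ψ I w + 2 * D + T.1 (g T)) *
                  (8 * expCost l (R * P.opt I z)) := by
                  gcongr
                  exact ih' z (by simp; omega) (g T)
              _ = 8 * expCost l ((Y + 2 * D + m + R * oz : ℝ≥0)) := by
                  rw [mul_left_comm, ← expCost_add, ← hY, ← hmT, ← hoz]
                  push_cast
                  rfl
              _ ≤ _ := by
                  rw [mul_assoc (8 : ℝ≥0∞), ← hox, ← hY, ← ENNReal.coe_mul, expCost_coe, expCost_coe,
                    ← ENNReal.ofReal_mul (Real.exp_pos _).le, ← Real.exp_add]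
                  gcongr
                  rw [hl]
                  push_cast
                  rw [ENNReal.coe_toReal, ← mul_add]
                  refine mul_le_mul_of_nonneg_left ?_ (by positivity)
                  -- The optimum `o'` of the phase pays for everything: `r * o'` covers `r * o + m`,
                  -- as `1 ≤ r`, and `η * r * o' ≥ η * r * C` covers the overhead.
                  have h1 : (R : ℝ) * (o' + oz) ≤ R * (ox + D) := by gcongr
                  have h2 : (η * r * C : ℝ) ≤ η * r * o' := by gcongr
                  have h3 : (r : ℝ) * (o + m) ≤ r * o' := by gcongr
                  have h4 : (1 : ℝ) * m ≤ r * m := by gcongr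
                  have h5 : (R : ℝ) * o' = r * o' + η * r * o' := by rw [hRr]; ring
                  rw [hb₁, hBr]
                  linarith
          · rw [if_neg hψ]
            refine (hfail w (T :: z) rfl hw ψ (not_le.1 hψ)).trans_eq ?_
            rw [expCost_coe, hl, hb₂]
            push_cast
            rw [add_assoc]
      _ = 8 * expCost l (R * P.opt I (w ++ T :: z)) * ∫⁻ ψ,
          ENNReal.ofReal (Real.exp (((M : ℝ) ^ 2)⁻¹ *
            (if A.cost ψ I w ≤ L then (A.cost ψ I w).toReal - b₁ else L + b₂))) ∂tapeMeasure := by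
          refine lintegral_const_mul' _ _ (ENNReal.mul_ne_top (by norm_num) (expCost_ne_top ?_))
          exact ENNReal.mul_ne_top ENNReal.coe_ne_top (P.opt_ne_top _ _)
      _ ≤ 8 * expCost l (R * P.opt I (w ++ T :: z)) * 1 := by
          gcongr
          refine lintegral_exp_le_one (A.measurable_cost I w) (a := r * o + α)
            (by push_cast; exact hlw) hL (by exact_mod_cast hM1) ?_ ?_ ?_ ?_ ?_
          · linarith
          · linarith
          · linarith
          · linarith
          · have h1 : (b₁ + b₂) * (r * o + α : ℝ≥0) / L ≤ 1 := by
              rw [div_le_one hLr]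
              refine le_trans ?_ hL₁r
              push_cast
              refine mul_le_mul (by linarith) (by linarith) (by positivity) (by positivity)
            have h2 : ((r * o + α : ℝ≥0) : ℝ) = r * o + α := by push_cast; ring
            linarith
      _ = _ := mul_one _

/-- A competitive ratio below one forces bounded optimal costs. -/
theorem competitiveWHP_of_lt_one {A : P.RandomizedOnlineAlgorithm} {r r' : ℝ≥0} (hr : r < 1)
    (hA : A.CompetitiveInExpectation r) : A.CompetitiveWHP r' := by
  obtain ⟨α, hα⟩ := hA
  intro β hβ
  -- Solve `Opt ≤ E cost ≤ r * Opt + α` for `Opt`.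
  have hopt : ∀ (I : P.init) x, P.opt I x ≤ (α / (1 - r) : ℝ≥0) := fun I x => by
    have h := (lintegral_mono fun φ => A.opt_le_cost φ I x).trans (hα I x)
    rw [lintegral_const, measure_univ, mul_one] at h
    obtain ⟨o, ho⟩ := exists_coe_eq_of_ne_top (P.opt_ne_top I x)
    rw [← ho] at h ⊢
    have h' : o ≤ r * o + α := by exact_mod_cast h
    rw [ENNReal.coe_le_coe, le_div_iff₀ (tsub_pos_of_lt hr), mul_tsub, mul_one,
      tsub_le_iff_left, mul_comm o]
    exact h'
  set U : ℝ≥0 := α / (1 - r)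
  set p : ℝ≥0 := (2 + U) ^ (-β) with hp
  have hp0 : 0 < p := NNReal.rpow_pos (by positivity)
  refine ⟨(r * U + α) / p + 1, fun I x => ?_⟩
  set t : ℝ≥0 := (r * U + α) / p + 1 with ht
  have ht0 : (t : ℝ≥0∞) ≠ 0 := by
    have : t ≠ 0 := by positivity
    exact_mod_cast this
  calc _ ≤ tapeMeasure {φ | (t : ℝ≥0∞) ≤ A.cost φ I x} :=
        measure_mono fun φ hφ => by
          rw [Set.mem_ofPred_eq] at *; exact le_add_self.trans hφ
    _ ≤ (∫⁻ φ, A.cost φ I x ∂tapeMeasure) / t :=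
        meas_ge_le_lintegral_div (A.measurable_cost I x).aemeasurable ht0 ENNReal.coe_ne_top
    _ ≤ (r * U + α : ℝ≥0) / t := by
        gcongr
        refine (hα I x).trans ?_
        push_cast
        gcongr
        exact hopt I x
    _ ≤ p := by
        rw [ENNReal.div_le_iff ht0 ENNReal.coe_ne_top, ← ENNReal.coe_mul, ENNReal.coe_le_coe, ht,
          mul_add, mul_div_cancel₀ _ hp0.ne']
        exact le_self_add
    _ = (2 + U : ℝ≥0∞) ^ (-β) := by
        rw [hp, ENNReal.coe_rpow_of_ne_zero (by positivity)]
        push_cast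
        rfl
    _ ≤ (2 + P.opt I x) ^ (-β) := by
        rw [ENNReal.rpow_neg, ENNReal.rpow_neg]
        gcongr
        exact hopt I x

theorem exists_competitiveWHP {A : P.RandomizedOnlineAlgorithm} {r η : ℝ≥0} (hr : 1 ≤ r)
    (hη : 0 < η) (hA : A.CompetitiveInExpectation r) :
    ∃ A' : P.RandomizedOnlineAlgorithm, A'.CompetitiveWHP ((1 + 2 * η) * r) := by
  obtain ⟨α, hα⟩ := hA
  rcases isEmpty_or_nonempty S with hS | hS
  · exact ⟨A, fun β _ => ⟨0, fun I => isEmptyElim (I : S)⟩⟩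
  choose g hg using fun T : P.Request => Finite.exists_min T.1
  obtain ⟨D, hD⟩ : ∃ D : ℝ≥0, ∀ s t, P.dist s t ≤ D := by
    obtain ⟨p, hp⟩ := Finite.exists_max fun p : S × S => P.dist p.1 p.2
    exact ⟨_, fun s t => hp (s, t)⟩
  have hr0 : 0 < r := one_pos.trans_le hr
  -- `C` gives equality in the drift condition. `L` is then large enough that an overrun adds at
  -- most 1 to the mean increment and has probability at most `1 / 8`.
  set C : ℝ≥0 := (2 + α + (2 * D + (1 + η) * r * D)) / (η * r) with hC
  set L : ℝ≥0 := (r * C + η * r * C + C) * (r * C + α) + 8 * (r * C + α) + 1 with hL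
  have hL₁ : (r * C + η * r * C + C) * (r * C + α) ≤ L :=
    le_self_add.trans (le_self_add (b := 1))
  have hL₂ : 8 * (r * C + α) ≤ L := by
    rw [hL, add_right_comm]; exact le_add_self
  obtain ⟨M, hM⟩ : ∃ M, M = L + (2 * D + (1 + η) * r * D) + C + r * C + η * r * C + 1 := ⟨_, rfl⟩
  have hM0 : 0 < M := by rw [hM]; positivity
  have key := restartMoment_le (M := M) hr hα hD hg (by positivity : 0 < C)
    (by rw [hC, mul_div_cancel₀ _ (by positivity)]) (by positivity : 0 < L)
    hL₁ hL₂ hM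
  set l := (M ^ 2)⁻¹ with hl
  have hl0 : 0 < l := by positivity
  -- The algorithm does not depend on `β`; only the additive constant does. The gap `η * r` between
  -- the two ratios is the decay rate, up to the factor `l`.
  refine ⟨A.restart g C L, fun β hβ => ?_⟩
  obtain ⟨a, ha⟩ := exists_rpow_le_exp (k := 8) (a := l * (η * r)) (β := β)
    (by positivity) (by linarith) (by norm_num) l (by exact_mod_cast hl0)
  refine ⟨a, fun I x => ?_⟩
  have hmom := key I x I
  rw [← lintegral_tape_eq_restartMoment] at hmom
  simp only [← cost_restart] at hmom
  obtain ⟨o, ho⟩ := exists_coe_eq_of_ne_top (P.opt_ne_top I x)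
  rw [← ho] at hmom ⊢
  set t : ℝ≥0 := (1 + 2 * η) * r * o + a with ht
  have ht' : ((1 + 2 * η) * r : ℝ≥0) * (o : ℝ≥0∞) + a = t := by rw [ht]; push_cast; ring
  have hmom' : ∫⁻ φ, expCost l ((A.restart g C L).cost φ I x) ∂tapeMeasure ≤
      ENNReal.ofReal (8 * Real.exp (l * ((1 + η) * r * o))) := by
    refine hmom.trans_eq ?_
    have : (1 + (η : ℝ≥0∞)) * r * o = ((1 + η) * r * o : ℝ≥0) := by push_cast; rfl
    rw [this, expCost_coe, ENNReal.ofReal_mul (by norm_num)]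
    push_cast
    simp
  have hm : Measurable fun φ => expCost l ((A.restart g C L).cost φ I x) :=
    (expCost_mono l).measurable.comp ((A.restart g C L).measurable_cost I x)
  have ht0 : expCost l t ≠ 0 := by
    rw [expCost_coe]
    simpa using Real.exp_pos _
  calc _ ≤ tapeMeasure {φ | expCost l t ≤ expCost l ((A.restart g C L).cost φ I x)} :=
        measure_mono fun φ hφ => by
          rw [Set.mem_ofPred_eq] at *; exact expCost_mono l (by rw [← ht']; exact hφ)
    _ ≤ (∫⁻ φ, expCost l ((A.restart g C L).cost φ I x) ∂tapeMeasure) / expCost l t :=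
        meas_ge_le_lintegral_div hm.aemeasurable ht0 (expCost_ne_top ENNReal.coe_ne_top)
    _ ≤ ENNReal.ofReal (8 * Real.exp (l * ((1 + η) * r * o))) / expCost l t := by gcongr
    _ = ENNReal.ofReal (8 * Real.exp (-(l * (η * r) * o + l * a))) := by
        rw [expCost_coe, ← ENNReal.ofReal_div_of_pos (Real.exp_pos _), mul_div_assoc,
          ← Real.exp_sub]
        congr 3
        rw [ht]
        push_cast
        ring
    _ ≤ ENNReal.ofReal ((2 + o) ^ (-β)) := ENNReal.ofReal_le_ofReal (ha o o.2)
    _ = (2 + o) ^ (-β) := by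
        rw [← ENNReal.ofReal_rpow_of_pos (by positivity),
          ENNReal.ofReal_add zero_le_two o.coe_nonneg]
        simp

end RandomizedOnlineAlgorithm

end TaskSystem

theorem theorem2 {S : Type*} [Finite S] (P : TaskSystem S) (r : ℝ≥0)
    (A : P.RandomizedOnlineAlgorithm) (hA : A.CompetitiveInExpectation r)
    (ε : ℝ≥0) (hε : 0 < ε) :
    ∃ A' : P.RandomizedOnlineAlgorithm, A'.CompetitiveWHP ((1 + ε) * r) := by
  rcases lt_or_ge r 1 with hr | hr
  · exact ⟨A, TaskSystem.RandomizedOnlineAlgorithm.competitiveWHP_of_lt_one hr hA⟩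
  · have := TaskSystem.RandomizedOnlineAlgorithm.exists_competitiveWHP hr (half_pos hε) hA
    rwa [mul_div_cancel₀ _ two_ne_zero] at this
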